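/- Let $d\in\mathbb N$ and let $\Phi:\mathbb R^d\to\mathbb R^d$ be a (homogeneous) quadratic mapping, i.e. each component of $\Phi$ is a real quadratic form. Let $J_\Phi(x)$ be the Jacobian determinant of $\Phi$ at $x$ and let $S=\{x\in\mathbb R^d : J_\Phi(x)=0\}$. Suppose that $X\subset\mathbb R^d$ is an open, simply connected set (in particular nonempty and path-connected), contained in $\Phi(\mathbb R^d)\setminus\Phi(S)$, such that the cardinality of $\Phi^{-1}(y)$ is the same for all $y\in X$. Then there exist an integer $k\in\{1,\dots,2^d\}$ and open, connected, pairwise disjoint sets $Y_1,\dots,Y_k\subset\mathbb R^d\setminus S$ such that $\Phi^{-1}(X)=\bigcup_{j=1}^k Y_j$ and, for every $j$, the restriction $\Phi|_{Y_j}:Y_j\to X$ is a ($C^\infty$) diffeomorphism. -/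

import Mathlib

open scoped ContDiff

noncomputable section

/-- The Jacobian (determinant of the derivative) of a self-map of `ℝ^d` at the point `x`. -/
def jacobian {d : ℕ} (f : EuclideanSpace ℝ (Fin d) → EuclideanSpace ℝ (Fin d))
    (x : EuclideanSpace ℝ (Fin d)) : ℝ :=
  (fderiv ℝ f x).det

/-- The set of critical points of a self-map of `ℝ^d`: the zero set of its Jacobian. -/
def criticalSet {d : ℕ} (f : EuclideanSpace ℝ (Fin d) → EuclideanSpace ℝ (Fin d)) :
    Set (EuclideanSpace ℝ (Fin d)) :=
  {x | jacobian f x = 0}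

/-- For open sets `U`, `V`: the map `f` restricts to a diffeomorphism from `U` onto `V`, that is,
a `C^∞` bijection with `C^∞` inverse. -/
def RestrictsToDiffeo {E F : Type*} [NormedAddCommGroup E] [NormedSpace ℝ E]
    [NormedAddCommGroup F] [NormedSpace ℝ F] (f : E → F) (U : Set E) (V : Set F) : Prop :=
  Set.BijOn f U V ∧ ContDiffOn ℝ ∞ f U ∧
    ∃ g : F → E, Set.InvOn g f U V ∧ ContDiffOn ℝ ∞ g V

end

/-! Over `X` every fibre of `Φ` is finite and consists of regular points. The inverse function
theorem supplies one local sheet through each point of a fibre, and constancy of the cardinality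
leaves no room for further points nearby, so `Φ` is a covering over `X`. As `X` is simply connected,
each point of one fibre extends to a continuous section; the images of these sections are the `Y j`.
The bound `k ≤ 2 ^ d` is a real Bézout inequality. Regular zeros of `Φ - y` survive the perturbation
`Φ - y + c (xᵢ²)ᵢ` for small `c`. For all but countably many `c`, the values of the `2 ^ d`
squarefree monomials separate the zeros of the perturbed system linearly
(`card_le_two_pow_of_surjective`). -/

/-! ### Algebra: counting zeros of a perturbed quadratic system. -/

namespace MvPolynomial

variable {σ K : Type*} [Field K]

open scoped Classical in
/-- The operator `x ^ m ↦ x ^ (m - 2 eᵢ) * f i` on monomials that are divisible by the square of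
some variable `xᵢ` (one such `i` is chosen), killing all squarefree monomials. -/
noncomputable def squareReduction (f : σ → MvPolynomial σ K) :
    MvPolynomial σ K →ₗ[K] MvPolynomial σ K :=
  (basisMonomials σ K).constr K fun m =>
    if h : ∃ i, 2 ≤ m i then monomial (m - Finsupp.single h.choose 2) 1 * f h.choose else 0

theorem squareReduction_monomial_of_squarefree (f : σ → MvPolynomial σ K) {m : σ →₀ ℕ}
    (h : ¬∃ i, 2 ≤ m i) : squareReduction f (monomial m 1) = 0 := by
  have := (basisMonomials σ K).constr_basis K (fun m : σ →₀ ℕ =>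
    open scoped Classical in if h : ∃ i, 2 ≤ m i then
      monomial (m - Finsupp.single h.choose 2) 1 * f h.choose else 0) m
  rw [dif_neg h] at this
  simpa [squareReduction] using this

theorem exists_squareReduction_monomial (f : σ → MvPolynomial σ K) {m : σ →₀ ℕ}
    (h : ∃ i, 2 ≤ m i) : ∃ i n, m = n + Finsupp.single i 2 ∧
      squareReduction f (monomial m 1) = monomial n 1 * f i := by
  have := (basisMonomials σ K).constr_basis K (fun m : σ →₀ ℕ =>
    open scoped Classical in if h : ∃ i, 2 ≤ m i then
      monomial (m - Finsupp.single h.choose 2) 1 * f h.choose else 0) m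
  rw [dif_pos h] at this
  refine ⟨h.choose, m - Finsupp.single h.choose 2, ?_, by simpa [squareReduction] using this⟩
  rw [tsub_add_cancel_of_le]
  rw [Finsupp.single_le_iff]
  exact h.choose_spec

theorem squareReduction_mem_restrictTotalDegree {f : σ → MvPolynomial σ K}
    (hf : ∀ i, (f i).totalDegree ≤ 2) (D : ℕ) {p : MvPolynomial σ K}
    (hp : p ∈ restrictTotalDegree σ K D) :
    squareReduction f p ∈ restrictTotalDegree σ K D := by
  rw [p.as_sum, map_sum]
  refine Submodule.sum_mem _ fun m hm => ?_
  have hmD : m.degree ≤ D :=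
    (le_totalDegree hm).trans ((mem_restrictTotalDegree _ _ _).1 hp)
  rw [show monomial m (coeff m p) = coeff m p • monomial m (1 : K) by
    rw [smul_monomial, smul_eq_mul, mul_one], map_smul]
  refine Submodule.smul_mem _ _ ?_
  by_cases h : ∃ i, 2 ≤ m i
  · obtain ⟨i, n, rfl, hT⟩ := exists_squareReduction_monomial f h
    rw [hT, mem_restrictTotalDegree]
    refine (totalDegree_mul _ _).trans ?_
    have h1 : (monomial n (1 : K)).totalDegree ≤ n.degree := totalDegree_monomial_le n 1
    have h2 := hf i
    simp only [map_add, Finsupp.degree_single] at hmD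
    omega
  · rw [squareReduction_monomial_of_squarefree f h]
    exact zero_mem _

/-- Reduction trades a square for a polynomial of degree at most 2, so it preserves each
finite-dimensional space of polynomials of degree at most `D`. There it has finitely many
eigenvalues, and unless `-c` is one of them the shifted operator is injective, hence surjective. -/
theorem countable_not_surjective_squareReduction_add [Finite σ] {f : σ → MvPolynomial σ K}
    (hf : ∀ i, (f i).totalDegree ≤ 2) :
    {c : K | ¬ Function.Surjective
      (squareReduction f + c • LinearMap.id : MvPolynomial σ K →ₗ[K] MvPolynomial σ K)}.Countable := by
  let R (D : ℕ) : Module.End K (restrictTotalDegree σ K D) :=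
    (squareReduction f).restrict fun _ hp => squareReduction_mem_restrictTotalDegree hf D hp
  refine (Set.countable_iUnion fun D : ℕ =>
    ((R D).finite_hasEigenvalue.countable.image (fun μ => -μ))).mono ?_
  intro c hc
  by_contra hcon
  apply hc
  intro p
  obtain ⟨D, hD⟩ : ∃ D, p ∈ restrictTotalDegree σ K D :=
    ⟨p.totalDegree, (mem_restrictTotalDegree _ _ _).2 le_rfl⟩
  have hev : ¬ (R D).HasEigenvalue (-c) := fun h =>
    hcon (Set.mem_iUnion.2 ⟨D, -c, h, neg_neg c⟩)
  have hinj : Function.Injective 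
      (R D + c • LinearMap.id : Module.End K (restrictTotalDegree σ K D)) := by
    rw [← LinearMap.ker_eq_bot]
    rw [Module.End.hasEigenvalue_iff, not_not, Module.End.eigenspace_def] at hev
    rw [← hev]
    congr 1
    ext v
    simp
  obtain ⟨q, hq⟩ := (LinearMap.injective_iff_surjective.1 hinj) ⟨p, hD⟩
  exact ⟨q, by simpa [R] using congrArg Subtype.val hq⟩

/-- The operator sends a monomial with a square to a multiple of some `f i + c xᵢ²`, which vanishes
at every `P j`, and a squarefree one to `c` times itself. A combination of evaluations that kills
squarefree monomials thus kills the whole image, which is everything; distinct evaluations are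
independent by Dedekind. -/
theorem card_le_two_pow_of_surjective [Fintype σ] {f : σ → MvPolynomial σ K} {c : K}
    (hc : Function.Surjective
      (squareReduction f + c • LinearMap.id : MvPolynomial σ K →ₗ[K] MvPolynomial σ K))
    {ι : Type*} [Fintype ι] {P : ι → σ → K} (hP : Function.Injective P)
    (hzero : ∀ j i, eval (P j) (f i) + c * P j i ^ 2 = 0) :
    Fintype.card ι ≤ 2 ^ Fintype.card σ := by
  classical
  let v : ι → Finset σ → K := fun j s => ∏ i ∈ s, P j i
  have hv : LinearIndependent K v := by
    rw [Fintype.linearIndependent_iff]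
    intro g hg
    have hmon (m : σ →₀ ℕ) : ∑ j, g j * eval (P j)
        ((squareReduction f + c • LinearMap.id : MvPolynomial σ K →ₗ[K] MvPolynomial σ K)
          (monomial m 1)) = 0 := by
      by_cases h : ∃ i, 2 ≤ m i
      · obtain ⟨i, n, rfl, hT⟩ := exists_squareReduction_monomial f h
        refine Finset.sum_eq_zero fun j _ => ?_
        have : monomial (n + Finsupp.single i 2) (1 : K) = monomial n 1 * X i ^ 2 := by
          rw [X_pow_eq_monomial, monomial_mul, one_mul]
        rw [LinearMap.add_apply, hT, this, LinearMap.smul_apply, LinearMap.id_apply, map_add,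
          smul_eval, map_mul, map_mul, map_pow, eval_X]
        linear_combination g j * eval (P j) (monomial n 1) * hzero j i
      · have hs := congrFun hg m.support
        simp only [Finset.sum_apply, Pi.smul_apply, smul_eq_mul, Pi.zero_apply, v] at hs
        have hm (j : ι) : eval (P j) (monomial m (1 : K)) = ∏ i ∈ m.support, P j i := by
          rw [eval_monomial, one_mul]
          refine Finset.prod_congr rfl fun i hi => ?_
          have h1 : m i ≠ 0 := Finsupp.mem_support_iff.1 hi
          have h2 : ¬ 2 ≤ m i := fun h' => h ⟨i, h'⟩
          simp [show m i = 1 by omega]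
        rw [LinearMap.add_apply, squareReduction_monomial_of_squarefree f h, zero_add]
        simp only [LinearMap.smul_apply, LinearMap.id_apply, smul_eval, hm]
        rw [← mul_zero c, ← hs, Finset.mul_sum]
        exact Finset.sum_congr rfl fun j _ => by ring
    have hall (p : MvPolynomial σ K) : ∑ j, g j * eval (P j) p = 0 := by
      obtain ⟨q, rfl⟩ := hc p
      let Λ : MvPolynomial σ K →ₗ[K] K := ∑ j, g j • (aeval (P j)).toLinearMap
      have hΛ : Λ ∘ₗ (squareReduction f + c • LinearMap.id) = 0 := by
        refine (basisMonomials σ K).ext fun m => ?_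
        simpa [Λ, aeval_eq_eval] using hmon m
      simpa [Λ, aeval_eq_eval] using LinearMap.congr_fun hΛ q
    have hinj : Function.Injective fun j => (eval (P j) : MvPolynomial σ K →* K) := by
      intro j j' h
      apply hP
      ext i
      simpa using DFunLike.congr_fun h (X i)
    have hli := (linearIndependent_monoidHom (MvPolynomial σ K) K).comp _ hinj
    refine Fintype.linearIndependent_iff.1 hli g ?_
    ext p
    simpa using hall p
  simpa using hv.fintype_card_le_finrank

/-- For all but countably many `c`, the perturbed quadratic system `fᵢ(x) + c xᵢ² = 0` has at most
`2 ^ d` solutions, where `d` is the number of variables. -/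
theorem exists_countable_encard_zeros_le [Fintype σ] {f : σ → MvPolynomial σ K}
    (hf : ∀ i, (f i).totalDegree ≤ 2) :
    ∃ B : Set K, B.Countable ∧ ∀ c ∉ B, ∀ n : ℕ, ∀ P : Fin n → σ → K, Function.Injective P →
      (∀ j i, eval (P j) (f i) + c * P j i ^ 2 = 0) → n ≤ 2 ^ Fintype.card σ := by
  refine ⟨_, countable_not_surjective_squareReduction_add hf, fun c hc n P hP hz => ?_⟩
  simpa using card_le_two_pow_of_surjective (not_not.1 hc) hP hz

end MvPolynomial

open Set Topology Filter

/-! ### Topology: coverings from fibre counts, and their sections. -/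

/-- A local homeomorphism along a finite fibre, whose nearby fibres are not larger, is evenly
covered at the base point. -/
theorem isEvenlyCovered_of_encard_fiber_le {E X : Type*} [TopologicalSpace E] [TopologicalSpace X]
    [T2Space E] {f : E → X} {x : X} (fin : (f ⁻¹' {x}).Finite) (hne : (f ⁻¹' {x}).Nonempty)
    (h : ∀ e ∈ f ⁻¹' {x}, ∃ φ : OpenPartialHomeomorph E X, e ∈ φ.source ∧ φ = f)
    (hcard : ∀ᶠ x' in 𝓝 x, (f ⁻¹' {x'}).encard ≤ (f ⁻¹' {x}).encard) :
    IsEvenlyCovered f x (f ⁻¹' {x}) := by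
  have : DiscreteTopology (f ⁻¹' {x}) :=
    (IsDiscrete.of_openPartialHomeomorph f subset_rfl h).1
  choose φ hφ using fun e : f ⁻¹' {x} ↦ h e e.2
  have ⟨V, hV, disj⟩ := fin.t2_separation
  let V' (e : f ⁻¹' {x}) := V e ∩ (φ e).source
  have hV' e : IsOpen (V' e) := (hV e).2.inter (φ e).open_source
  have hdisj : Pairwise (Function.onFun Disjoint V') :=
    pairwise_disjoint_mono disj.subtype fun e ↦ inter_subset_left
  have : Nonempty (f ⁻¹' {x}) := hne.to_subtype
  have ⟨U, hUW, hU, hxU⟩ := mem_nhds_iff.mp hcard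
  let U' := U ∩ ⋂ e : f ⁻¹' {x}, f '' (V' e)
  have : Finite (f ⁻¹' {x}) := fin
  have hU' : IsOpen U' := hU.inter <| isOpen_iInter_of_finite fun e ↦ by
    convert! ← (φ e).isOpen_image_of_subset_source (hV' _) inter_subset_right; exact (hφ e).2
  have hUV e : U' ⊆ f '' V' e := inter_subset_right.trans (iInter_subset ..)
  have hexh : f ⁻¹' U' ⊆ ⋃ e, V' e := by
    intro a ha
    choose g hgV hga using fun e => hUV e ha
    have hginj : Function.Injective g := fun e e' hee => by
      by_contra hne'
      exact (hdisj hne').le_bot ⟨hgV e, hee ▸ hgV e'⟩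
    -- The sheets already give as many points over `f a` as lie over `x`, so the fibre of `f a` has
    -- no others.
    have hr : range g = f ⁻¹' {f a} := by
      refine (finite_range g).eq_of_subset_of_encard_le ?_ ?_
      · rintro _ ⟨e, rfl⟩
        exact hga e
      · exact (hUW ha.1).trans hginj.encard_range
    obtain ⟨e, he⟩ : a ∈ range g := hr ▸ rfl
    exact mem_iUnion.2 ⟨e, he ▸ hgV e⟩
  have : Nonempty E := ⟨Classical.arbitrary (f ⁻¹' {x})⟩
  refine .of_trivialization (t := hU'.trivializationDiscrete _ _
    (fun e s hs ↦ ⟨fun h ↦ ?_, fun h ↦ ?_⟩) (fun e ↦ ?_)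
    (fun e ↦ .mono subset_rfl (hUV e) (surjOn_image f _))
    hdisj hexh)
    ⟨hxU, Set.mem_iInter.mpr fun e ↦ ⟨e, ⟨(hV e).1, (hφ e).1⟩, e.2⟩⟩
  · convert! ((φ e).isOpen_inter_preimage h).inter (hV e).2 using 1
    simp_rw [(hφ e).2, V']; ac_rfl
  · have : s ⊆ (φ e).target := hs.trans <| (hUV e).trans <| by
      rw [← (φ e).image_source_eq_target, (hφ e).2]; exact image_mono inter_subset_right
    rw [← (φ e).isOpen_symm_image_iff_of_subset_target this,
      (φ e).symm_image_eq_source_inter_preimage this, (hφ e).2, inter_comm]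
    convert! h using 1
    refine inter_eq_inter_iff_left.mpr ⟨fun e' h ↦ h.2.2, fun e' h ↦ ⟨?_ , h.2⟩⟩
    have ⟨e'', ⟨_, mem⟩, eq⟩ := mem_iInter.mp (hs h.1).2 e
    rwa [← (φ e).injOn mem h.2 (by rwa [(hφ e).2])]
  · convert! ← (φ e).injOn.mono inter_subset_right; exact (hφ e).2

/-- Over an open simply connected set, a covering map restricted to finite fibres of cardinality `k`
has `k` continuous sections, whose images are disjoint and cover the preimage. -/
theorem IsCoveringMapOn.exists_sections {E X : Type*} [TopologicalSpace E] [TopologicalSpace X]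
    [LocallyPathConnectedSpace X] {p : E → X} {s : Set X} (cov : IsCoveringMapOn p s)
    (hs : IsOpen s) (hsc : IsSimplyConnected s) {x₀ : X} (hx₀ : x₀ ∈ s)
    (hfin : (p ⁻¹' {x₀}).Finite)
    (hcard : ∀ y ∈ s, (p ⁻¹' {y}).encard = (p ⁻¹' {x₀}).encard) :
    ∃ σ : p ⁻¹' {x₀} → C(s, E), (∀ e y, p (σ e y) = y) ∧
      (∀ e e' y y', σ e y = σ e' y' → e = e') ∧ ∀ a, p a ∈ s → ∃ e y, σ e y = a := by
  have := hsc.simplyConnectedSpace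
  have := hs.locallyPathConnectedSpace
  let ι : C(s, X) := ⟨Subtype.val, continuous_subtype_val⟩
  have key (e : E) (y : s) (he : p e = y) :=
    cov.existsUnique_continuousMap_lifts ι (a₀ := y) (e₀ := e) he (fun a => a.2)
  choose σ hσ hσ' using fun e : p ⁻¹' {x₀} => key e ⟨x₀, hx₀⟩ e.2
  have hsec e y : p (σ e y) = y := congrFun (hσ e).2 y
  have hdis : ∀ e e' y y', σ e y = σ e' y' → e = e' := by
    intro e e' y y' h
    have hy : y = y' := Subtype.ext (by rw [← hsec e y, h, hsec e' y'])
    subst hy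
    -- Lifts that agree at one point coincide, so their values over `x₀` agree.
    have heq : σ e = σ e' :=
      (key (σ e y) y (hsec e y)).unique ⟨rfl, (hσ e).2⟩ ⟨h.symm, (hσ e').2⟩
    exact Subtype.ext (by rw [← (hσ e).1, ← (hσ e').1, heq])
  refine ⟨σ, hsec, hdis, fun a ha => ?_⟩
  have : Finite (p ⁻¹' {x₀}) := hfin
  have hinj : Function.Injective fun e => σ e ⟨p a, ha⟩ := fun e e' h => hdis _ _ _ _ h
  have hr : range (fun e => σ e ⟨p a, ha⟩) = p ⁻¹' {p a} := by
    refine (finite_range _).eq_of_subset_of_encard_le ?_ ?_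
    · rintro _ ⟨e, rfl⟩
      exact hsec e _
    · exact (hcard _ ha).le.trans hinj.encard_range
  obtain ⟨e, he⟩ : a ∈ range (fun e => σ e ⟨p a, ha⟩) := hr ▸ rfl
  exact ⟨e, _, he⟩

/-! ### Analysis: persistence of zeros and the Bézout bound. -/

/-- Surjectivity of the derivative makes a zero persist under small perturbations. -/
theorem eventually_exists_add_smul_eq {E : Type*} [NormedAddCommGroup E] [NormedSpace ℝ E]
    [CompleteSpace E] {f q : E → E} {x : E} (hf : ContDiff ℝ ∞ f) (hq : ContDiff ℝ ∞ q)
    (hsurj : Function.Surjective (fderiv ℝ f x)) {U : Set E} (hU : U ∈ 𝓝 x) :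
    ∀ᶠ c : ℝ in 𝓝 0, ∃ z ∈ U, f z + c • q z = f x := by
  -- With the parameter as an extra coordinate, openness of `G` at `(x, 0)` handles all small `c` at
  -- once.
  let G : E × ℝ → E × ℝ := fun p => (f p.1 + p.2 • q p.1, p.2)
  have hG : ContDiff ℝ ∞ G := by fun_prop
  have hder : HasStrictFDerivAt G (fderiv ℝ G (x, 0)) (x, 0) :=
    hG.contDiffAt.hasStrictFDerivAt (by simp)
  have hder' : HasFDerivAt G
      (((fderiv ℝ f x ∘L ContinuousLinearMap.fst ℝ E ℝ) +
        (ContinuousLinearMap.snd ℝ E ℝ).smulRight (q x)).prod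
        (ContinuousLinearMap.snd ℝ E ℝ)) (x, 0) := by
    have h1 : HasFDerivAt (fun p : E × ℝ => f p.1)
        (fderiv ℝ f x ∘L ContinuousLinearMap.fst ℝ E ℝ) (x, 0) :=
      ((hf.differentiable (by simp) x).hasFDerivAt).comp (x, (0 : ℝ)) hasFDerivAt_fst
    have h2 : HasFDerivAt (fun p : E × ℝ => q p.1)
        (fderiv ℝ q x ∘L ContinuousLinearMap.fst ℝ E ℝ) (x, 0) :=
      ((hq.differentiable (by simp) x).hasFDerivAt).comp (x, (0 : ℝ)) hasFDerivAt_fst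
    have h3 : HasFDerivAt (fun p : E × ℝ => p.2) (ContinuousLinearMap.snd ℝ E ℝ) (x, 0) :=
      hasFDerivAt_snd
    refine ((h1.add (h3.smul h2)).prodMk h3).congr_fderiv ?_
    simp
  have hGs : (fderiv ℝ G (x, 0)).range = ⊤ := by
    rw [hder'.fderiv, LinearMap.range_eq_top]
    rintro ⟨w, t⟩
    obtain ⟨u, hu⟩ := hsurj (w - t • q x)
    exact ⟨(u, t), by simp [hu]⟩
  have hmap := hder.map_nhds_eq_of_surj hGs
  have himg : G '' (U ×ˢ univ) ∈ 𝓝 (f x, (0 : ℝ)) := by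
    have h0 : G (x, 0) = (f x, 0) := by simp [G]
    rw [← h0, ← hmap]
    exact image_mem_map (prod_mem_nhds hU univ_mem)
  have hlim : Tendsto (fun c : ℝ => (f x, c)) (𝓝 0) (𝓝 (f x, 0)) :=
    (Continuous.prodMk_right (f x)).tendsto 0
  filter_upwards [hlim himg] with c hc
  obtain ⟨⟨z, t⟩, hz, hzt⟩ := hc
  obtain ⟨h1, rfl⟩ := Prod.mk.inj hzt
  exact ⟨z, hz.1, h1⟩

namespace QuadraticMap

variable {d : ℕ} (Φ : QuadraticMap ℝ (EuclideanSpace ℝ (Fin d)) (EuclideanSpace ℝ (Fin d)))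

theorem apply_eq_sum_associated (x : EuclideanSpace ℝ (Fin d)) :
    Φ x = ∑ a, ∑ b, (x a * x b) • associated (R := ℝ) Φ
      (EuclideanSpace.basisFun (Fin d) ℝ a) (EuclideanSpace.basisFun (Fin d) ℝ b) := by
  conv_lhs => rw [← associated_eq_self_apply ℝ Φ x,
    ← (EuclideanSpace.basisFun (Fin d) ℝ).sum_repr x]
  simp only [map_sum, map_smul, LinearMap.sum_apply, LinearMap.smul_apply, Finset.smul_sum,
    smul_smul, EuclideanSpace.basisFun_repr]
  rw [Finset.sum_comm]
  exact Finset.sum_congr rfl fun a _ => Finset.sum_congr rfl fun b _ => by rw [mul_comm]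

theorem contDiff_coe : ContDiff ℝ ∞ Φ := by
  rw [show (Φ : EuclideanSpace ℝ (Fin d) → EuclideanSpace ℝ (Fin d)) = _ from
    funext Φ.apply_eq_sum_associated]
  fun_prop

theorem exists_mvPolynomial_eval (i : Fin d) : ∃ F : MvPolynomial (Fin d) ℝ,
    F.totalDegree ≤ 2 ∧ ∀ x : EuclideanSpace ℝ (Fin d), F.eval x = Φ x i := by
  refine ⟨∑ a, ∑ b, MvPolynomial.C (associated (R := ℝ) Φ
      (EuclideanSpace.basisFun (Fin d) ℝ a) (EuclideanSpace.basisFun (Fin d) ℝ b) i) *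
      (MvPolynomial.X a * MvPolynomial.X b), ?_, fun x => ?_⟩
  · refine MvPolynomial.totalDegree_finsetSum_le fun a _ =>
      MvPolynomial.totalDegree_finsetSum_le fun b _ => ?_
    refine (MvPolynomial.totalDegree_mul _ _).trans ?_
    rw [MvPolynomial.totalDegree_C, zero_add]
    refine (MvPolynomial.totalDegree_mul _ _).trans ?_
    simp
  · conv_rhs => rw [apply_eq_sum_associated]
    simp [mul_comm]

/-- Bézout bound: a regular value of a quadratic self-map of `ℝ ^ d` has at most `2 ^ d`
preimages. -/
theorem encard_preimage_le_two_pow {y : EuclideanSpace ℝ (Fin d)}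
    (hy : y ∉ Φ '' criticalSet Φ) : (Φ ⁻¹' {y}).encard ≤ (2 ^ d : ℕ) := by
  by_contra hlt
  obtain ⟨t, htsub, htcard⟩ := exists_subset_encard_eq
    (show ((2 ^ d + 1 : ℕ) : ℕ∞) ≤ (Φ ⁻¹' {y}).encard by
      push_cast
      exact Order.add_one_le_of_lt (by simpa using hlt))
  have htfin : t.Finite := finite_of_encard_eq_coe htcard
  -- Disjoint neighbourhoods keep the perturbed zeros distinct.
  obtain ⟨U, hU, hdisj⟩ := htfin.t2_separation
  choose F hFdeg hF using Φ.exists_mvPolynomial_eval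
  obtain ⟨B, hB, hbound⟩ := MvPolynomial.exists_countable_encard_zeros_le
    (f := fun i => F i - MvPolynomial.C (y i)) fun i =>
      (MvPolynomial.totalDegree_sub_C_le _ _).trans (hFdeg i)
  let q : EuclideanSpace ℝ (Fin d) → EuclideanSpace ℝ (Fin d) :=
    fun x => WithLp.toLp 2 fun i => x i ^ 2
  have hq : ContDiff ℝ ∞ q := by
    rw [contDiff_euclidean]
    intro i
    simp only [q]
    fun_prop
  have hev : ∀ᶠ c : ℝ in 𝓝 0, ∀ x ∈ t, ∃ z ∈ U x, Φ z + c • q z = y := by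
    rw [htfin.eventually_all]
    intro x hx
    have hxy : Φ x = y := htsub hx
    have hdet : (fderiv ℝ Φ x).det ≠ 0 := fun h => hy ⟨x, h, hxy⟩
    have hsurj : Function.Surjective (fderiv ℝ Φ x) := by
      have := ((fderiv ℝ Φ x).toContinuousLinearEquivOfDetNeZero hdet).surjective
      exact fun w => (this w).imp fun u hu => by simpa using hu
    simpa only [hxy] using eventually_exists_add_smul_eq Φ.contDiff_coe hq hsurj
      ((hU x).2.mem_nhds (hU x).1)
  -- A countable set is not a neighbourhood of `0`.
  obtain ⟨c, hc, hcB⟩ : ∃ c : ℝ, (∀ x ∈ t, ∃ z ∈ U x, Φ z + c • q z = y) ∧ c ∉ B := by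
    by_contra! hcon
    have : B ∈ 𝓝 (0 : ℝ) := mem_of_superset hev hcon
    exact (hB.dense_compl ℝ).inter_nhds_nonempty this |>.elim fun c hc => hc.1 hc.2
  choose! z hzU hz using hc
  have hinj : InjOn z t := fun a ha b hb hab => by
    by_contra hne
    exact (hdisj ha hb hne).le_bot ⟨hzU a ha, hab ▸ hzU b hb⟩
  have : Fintype t := htfin.fintype
  have hcard : Fintype.card t = 2 ^ d + 1 := by
    rw [← Nat.card_eq_fintype_card, Nat.card_coe_set_eq, ncard, htcard]
    rfl
  let e := (Fintype.equivFinOfCardEq hcard).symm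
  have := hbound c hcB (2 ^ d + 1) (fun j i => z (e j) i) (fun j j' h => by
    apply e.injective
    apply Subtype.ext
    apply hinj (e j).2 (e j').2
    ext i
    exact congrFun h i) fun j i => by
      have h1 := congrArg (fun w : EuclideanSpace ℝ (Fin d) => w i) (hz _ (e j).2)
      simp only [PiLp.add_apply, PiLp.smul_apply, q, smul_eq_mul] at h1
      rw [map_sub, MvPolynomial.eval_C, hF]
      linarith
  simp at this

end QuadraticMap

/-! ### Smooth sections and assembly of the pieces. -/

theorem restrictsToDiffeo_range_section {E : Type*} [NormedAddCommGroup E] [NormedSpace ℝ E]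
    [CompleteSpace E] {f : E → E} (hf : ContDiff ℝ ∞ f)
    {V : Set E} (hV : IsOpen V) (σ : C(V, E)) (hσ : ∀ y, f (σ y) = y)
    (hinv : ∀ y, ∃ f' : E ≃L[ℝ] E, HasFDerivAt f (f' : E →L[ℝ] E) (σ y)) :
    IsOpen (range σ) ∧ RestrictsToDiffeo f (range σ) V := by
  classical
  -- The value off `V` is irrelevant, since `V` is open.
  let g : E → E := fun y => if h : y ∈ V then σ ⟨y, h⟩ else 0
  have hg (y : V) : g y = σ y := by simp [g]
  have hgcont : ContinuousOn g V := by
    rw [continuousOn_iff_continuous_domRestrict]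
    convert σ.continuous using 1
    ext y
    exact hg y
  have hloc (y : V) : ∃ φ : OpenPartialHomeomorph E E, σ y ∈ φ.source ∧ (φ : E → E) = f ∧
      ContDiffAt ℝ ∞ φ.symm y := by
    obtain ⟨f', hf'⟩ := hinv y
    have hcd : ContDiffAt ℝ ∞ f (σ y) := hf.contDiffAt
    refine ⟨hcd.toOpenPartialHomeomorph f hf' (by simp),
      hcd.mem_toOpenPartialHomeomorph_source hf' (by simp), rfl, ?_⟩
    have := hcd.to_localInverse hf' (by simp)
    rwa [hσ y] at this
  refine ⟨?_, ⟨?_, ?_, ?_⟩, hf.contDiffOn, g, ⟨?_, ?_⟩, ?_⟩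
  · rw [isOpen_iff_mem_nhds]
    rintro _ ⟨y, rfl⟩
    obtain ⟨φ, hsrc, hφ, -⟩ := hloc y
    have hfc : ContinuousAt f (σ y) := hf.continuous.continuousAt
    have hgc : ContinuousAt g (f (σ y)) := by
      rw [hσ y]
      exact hgcont.continuousAt (hV.mem_nhds y.2)
    have h1 : ∀ᶠ x in 𝓝 (σ y), f x ∈ V := hfc (by rw [hσ y]; exact hV.mem_nhds y.2)
    have h2 : ∀ᶠ x in 𝓝 (σ y), g (f x) ∈ φ.source := by
      refine (hgc.comp hfc).eventually_mem (φ.open_source.mem_nhds ?_)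
      simpa [hσ y, hg] using hsrc
    -- Near `σ y`, both `x` and `g (f x)` lie where `f` is injective and have the same image.
    filter_upwards [h1, h2, φ.open_source.mem_nhds hsrc] with x hx hgx hxs
    refine ⟨⟨f x, hx⟩, ?_⟩
    rw [← hg]
    apply φ.injOn hgx hxs
    rw [hφ, hg ⟨f x, hx⟩, hσ]
  · rintro _ ⟨y, rfl⟩
    rw [hσ]
    exact y.2
  · rintro _ ⟨y, rfl⟩ _ ⟨y', rfl⟩ h
    rw [hσ, hσ] at h
    rw [Subtype.ext h]
  · exact fun y hy => ⟨σ ⟨y, hy⟩, ⟨_, rfl⟩, hσ _⟩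
  · rintro _ ⟨y, rfl⟩
    rw [hσ, hg]
  · intro y hy
    rw [hg ⟨y, hy⟩, hσ]
  · intro y hy
    obtain ⟨φ, hsrc, hφ, hsm⟩ := hloc ⟨y, hy⟩
    refine (hsm.congr_of_eventuallyEq ?_).contDiffWithinAt
    have h2 : ∀ᶠ w in 𝓝 y, g w ∈ φ.source :=
      (hgcont.continuousAt (hV.mem_nhds hy)).eventually_mem
        (φ.open_source.mem_nhds (by rw [hg ⟨y, hy⟩]; exact hsrc))
    -- Near `y` the section equals the smooth local inverse.
    filter_upwards [hV.mem_nhds hy, h2] with w hw hgw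
    have h3 := φ.left_inv hgw
    rw [hφ, hg ⟨w, hw⟩, hσ] at h3
    rw [hg ⟨w, hw⟩, h3]

theorem proposition4p2 (d : ℕ)
    (Φ : QuadraticMap ℝ (EuclideanSpace ℝ (Fin d)) (EuclideanSpace ℝ (Fin d)))
    (X : Set (EuclideanSpace ℝ (Fin d)))
    (hXopen : IsOpen X) (hXsc : IsSimplyConnected X)
    (hX : X ⊆ Set.range Φ \ (Φ '' criticalSet Φ))
    (hcard : ∀ y ∈ X, ∀ y' ∈ X, (Φ ⁻¹' {y}).encard = (Φ ⁻¹' {y'}).encard) :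
    ∃ k : ℕ, 1 ≤ k ∧ k ≤ 2 ^ d ∧
      ∃ Y : Fin k → Set (EuclideanSpace ℝ (Fin d)),
        (∀ j, IsOpen (Y j)) ∧
        (∀ j, IsConnected (Y j)) ∧
        Pairwise (fun i j => Disjoint (Y i) (Y j)) ∧
        (∀ j, Y j ⊆ (criticalSet Φ)ᶜ) ∧
        Φ ⁻¹' X = ⋃ j, Y j ∧
        ∀ j, RestrictsToDiffeo Φ (Y j) X := by
  obtain ⟨y₀, hy₀⟩ := hXsc.nonempty
  have hbound (y) (hy : y ∈ X) := Φ.encard_preimage_le_two_pow (hX hy).2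
  have hfin (y) (hy : y ∈ X) : (Φ ⁻¹' {y}).Finite :=
    finite_of_encard_le_coe (hbound y hy)
  have hne (y) (hy : y ∈ X) : (Φ ⁻¹' {y}).Nonempty := (hX hy).1
  have hreg (x) (hx : Φ x ∈ X) : x ∉ criticalSet Φ := fun h => (hX hx).2 ⟨x, h, rfl⟩
  have hderiv (x) (hx : Φ x ∈ X) : ∃ f' : EuclideanSpace ℝ (Fin d) ≃L[ℝ] EuclideanSpace ℝ (Fin d),
      HasFDerivAt Φ (f' : EuclideanSpace ℝ (Fin d) →L[ℝ] EuclideanSpace ℝ (Fin d)) x := by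
    have hdet : (fderiv ℝ Φ x).det ≠ 0 := hreg x hx
    refine ⟨(fderiv ℝ Φ x).toContinuousLinearEquivOfDetNeZero hdet, ?_⟩
    rw [ContinuousLinearMap.coe_toContinuousLinearEquivOfDetNeZero]
    exact (Φ.contDiff_coe.differentiable (by simp) x).hasFDerivAt
  have hcov : IsCoveringMapOn Φ X := fun y hy => by
    refine isEvenlyCovered_of_encard_fiber_le (hfin y hy) (hne y hy) (fun e he => ?_) ?_
    · have he' : Φ e = y := he
      obtain ⟨f', hf'⟩ := hderiv e (he' ▸ hy)
      have hcd : ContDiffAt ℝ ∞ Φ e := Φ.contDiff_coe.contDiffAt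
      exact ⟨hcd.toOpenPartialHomeomorph Φ hf' (by simp),
        hcd.mem_toOpenPartialHomeomorph_source hf' (by simp), rfl⟩
    · filter_upwards [hXopen.mem_nhds hy] with y' hy'
      exact (hcard y' hy' y hy).le
  obtain ⟨σ, hσ, hdis, hsurj⟩ := hcov.exists_sections hXopen hXsc hy₀ (hfin y₀ hy₀)
    fun y hy => hcard y hy y₀ hy₀
  have : Fintype (Φ ⁻¹' {y₀}) := (hfin y₀ hy₀).fintype
  have : Nonempty (Φ ⁻¹' {y₀}) := (hne y₀ hy₀).to_subtype
  have := hXsc.simplyConnectedSpace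
  let e := (Fintype.equivFin (Φ ⁻¹' {y₀})).symm
  have hdiff (j) := restrictsToDiffeo_range_section Φ.contDiff_coe hXopen (σ (e j))
    (hσ (e j)) fun y => hderiv _ (by rw [hσ]; exact y.2)
  refine ⟨_, Fintype.card_pos, ?_, fun j => range (σ (e j)), fun j => (hdiff j).1,
    fun j => isConnected_range (σ (e j)).continuous, fun i j hij => ?_, fun j => ?_, ?_,
    fun j => (hdiff j).2⟩
  · have := hbound y₀ hy₀
    rw [encard, ENat.card_eq_coe_fintype_card] at this
    exact_mod_cast this
  · refine Set.disjoint_left.2 ?_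
    rintro _ ⟨y, rfl⟩ ⟨y', h⟩
    exact hij (e.injective (hdis _ _ _ _ h.symm))
  · rintro _ ⟨y, rfl⟩
    exact hreg _ (by rw [hσ]; exact y.2)
  · ext a
    simp only [mem_preimage, mem_iUnion, mem_range]
    constructor
    · intro ha
      obtain ⟨b, y, h⟩ := hsurj a ha
      exact ⟨e.symm b, y, by simpa using h⟩
    · rintro ⟨j, y, rfl⟩
      rw [hσ]
      exact y.2
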